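/- Let $X$ be a non-separable reflexive Banach space over $\mathbb{R}$ or $\mathbb{C}$. For a bounded linear operator $T : X \to X$ and $x \in X$, let the J-set $J_T(x)$ be the set of all $y \in X$ for which there exist a strictly increasing sequence $(k_n)$ of natural numbers and a sequence $(x_n)$ in $X$ such that $x_n \to x$ and $T^{k_n} x_n \to y$. Let $A_T = \{x \in X : J_T(x) = X\}$, and call $T$ a J-class operator if $J_T(x) = X$ for some $x \in X \setminus \{0\}$. Then for every infinite-dimensional separable closed subspace $Y \subseteq X$ and every real $\lambda \in (1,\infty)$ there exists a J-class operator $T : X \to X$ with $Y \subseteq A_T$ and $\|T\| = \lambda$. -/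

import Mathlib

open Filter Topology

namespace JClass

variable {𝕜 : Type*} [RCLike 𝕜] {X : Type*} [NormedAddCommGroup X] [NormedSpace 𝕜 X]

/-- The J-set of `x` under the bounded operator `T`: all `y` for which there are a strictly
increasing sequence `k` of natural numbers and a sequence `u` in `X` with `u n → x` and
`T ^ (k n) (u n) → y`. -/
def JSet (T : X →L[𝕜] X) (x : X) : Set X :=
  {y | ∃ (k : ℕ → ℕ) (u : ℕ → X), StrictMono k ∧ Tendsto u atTop (𝓝 x) ∧
    Tendsto (fun n => (T ^ k n) (u n)) atTop (𝓝 y)}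

/-- `A_T`: the set of all vectors whose J-set is the whole space. -/
def ASet (T : X →L[𝕜] X) : Set X :=
  {x | JSet T x = Set.univ}

/-- `T` is a J-class operator if some nonzero vector has the whole space as its J-set. -/
def IsJClass (T : X →L[𝕜] X) : Prop :=
  ∃ x : X, x ≠ 0 ∧ JSet T x = Set.univ

variable (𝕜 X) in
/-- A normed space is reflexive if the canonical map into its bidual is onto. -/
def IsReflexive : Prop :=
  Function.Surjective (NormedSpace.inclusionInDoubleDual 𝕜 X)

end JClass

/-!
The operator is `T = P + μ (1 - P) + K P`, where `P` is a bounded projection of `X` onto a separable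
subspace `Z` containing `Y`, `1 < μ`, and `K` is an operator of small norm for which `1 + K` is
topologically mixing on `Z`.

* `P` exists because `X` is reflexive (`IsReflexive.exists_separable_projection`): a countable
  back-and-forth between vectors and functionals produces a separable `Z ⊇ Y` and a separable space
  of functionals that norm each other, and then `Z` is complemented by the common kernel of the
  functionals.
* `K` comes from a biorthogonal sequence with closed span `Z`, rescaled to a sequence `f` such that
  `K (f n) = ∑ i < n, n.choose i • f i` still defines an operator of norm at most a given `δ > 0`
  (`exists_small_forward_difference`). With `f n` in the role of the monomial `X ^ n`, the operator
  `1 + K` is the translation `p ↦ p(x + 1)` of polynomials, and explicit polynomials show that it is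
  mixing on `Z` (`pair_mem_mixingSubmodule_of_binomial`). These computations are needed only for
  the pairs `(X ^ m, 0)` and `(0, X ^ m)`, because the pairs `(x, y)` such that the `n`-th power
  maps points near `x` to points near `y`, for all large `n`, form a closed subspace.
* On `ker P` the operator is `μ`, so it maps the null sequence `μ ^ (-n) • w` to `w`. Together with
  the mixing on `Z` this gives `JSet T z = X` for every `z ∈ Z`.
* `‖T‖` depends continuously on `μ`. At `μ = 1` it is at most `1 + ‖K P‖ < c`, and at `μ = c` it is
  at least `c`, since `ker P ≠ 0` when `X` is not separable. So some `μ > 1` gives `‖T‖ = c`.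
-/

namespace JClass

section

variable {𝕜 : Type*} [RCLike 𝕜] {X : Type*} [NormedAddCommGroup X] [NormedSpace 𝕜 X]

/-! ### Separable complemented subspaces of reflexive spaces -/

theorem exists_dual_eq_one_of_notMem (p : Submodule 𝕜 X) (hp : IsClosed (p : Set X)) {x : X}
    (hx : x ∉ p) : ∃ f : StrongDual 𝕜 X, (∀ y ∈ p, f y = 0) ∧ f x = 1 := by
  have := hp
  have hne : p.mkQL x ≠ 0 := by simpa using hx
  obtain ⟨f, hf⟩ := SeparatingDual.exists_eq_one (R := 𝕜) hne
  refine ⟨f ∘L p.mkQL, fun y hy => ?_, by simpa using hf⟩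
  have : p.mkQL y = 0 := by simpa using hy
  simp [this]

theorem IsReflexive.exists_norming_vector (h : IsReflexive 𝕜 X) (f : StrongDual 𝕜 X) :
    ∃ x : X, ‖x‖ ≤ 1 ∧ f x = ‖f‖ := by
  obtain ⟨Φ, hΦ, hf⟩ := exists_dual_vector'' 𝕜 f
  obtain ⟨x, rfl⟩ := h Φ
  refine ⟨x, ?_, by simpa using hf⟩
  rw [← (NormedSpace.inclusionInDoubleDualLi 𝕜 (E := X)).norm_map x]
  exact hΦ

/-- The common kernel of a set of functionals is closed, being an intersection of kernels. -/
theorem isClosed_dualCoannihilator (F : Set (StrongDual 𝕜 X)) :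
    IsClosed {x : X | ∀ f ∈ F, f x = 0} := by
  simp only [Set.ofPred_forall]
  exact isClosed_biInter fun f _ => isClosed_eq f.continuous continuous_const

/-- The countable set from which the complemented subspace is built. Here `g` selects a functional
norming a given vector and `h` a vector norming a given functional; `A` is, up to closure, stable
under linear combinations, and under `h` applied to linear combinations of functionals
in `g '' A`. -/
theorem exists_countable_back_and_forth (g : X → StrongDual 𝕜 X) (h : StrongDual 𝕜 X → X)
    {D : Set X} (hD : D.Countable) :
    ∃ A : Set X, A.Countable ∧ D ⊆ A ∧ (Submodule.span 𝕜 A : Set X) ⊆ closure A ∧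
      (Submodule.span 𝕜 (g '' A) : Set (StrongDual 𝕜 X)) ⊆ closure {f | h f ∈ A} := by
  have step : ∀ A : {A : Set X // A.Countable}, ∃ B : {A : Set X // A.Countable},
      A.1 ⊆ B.1 ∧ (Submodule.span 𝕜 A.1 : Set X) ⊆ closure B.1 ∧
      (Submodule.span 𝕜 (g '' A.1) : Set (StrongDual 𝕜 X)) ⊆ closure {f | h f ∈ B.1} := by
    rintro ⟨A, hA⟩
    obtain ⟨s, -, hsc, hs⟩ :=
      (hA.isSeparable.span (R := 𝕜)).exists_countable_dense_subset
    obtain ⟨t, -, htc, ht⟩ :=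
      ((hA.image g).isSeparable.span (R := 𝕜)).exists_countable_dense_subset
    refine ⟨⟨A ∪ (s ∪ h '' t), hA.union (hsc.union (htc.image h))⟩, Set.subset_union_left,
      hs.trans (closure_mono fun x hx => Or.inr (Or.inl hx)),
      ht.trans (closure_mono fun f hf => Or.inr (Or.inr ⟨f, hf, rfl⟩))⟩
  choose next hsub hspan hdual using step
  let S : ℕ → {A : Set X // A.Countable} := fun n => next^[n] ⟨D, hD⟩
  have hS : ∀ n, S (n + 1) = next (S n) := fun n => Function.iterate_succ_apply' next n _
  have hmono : Monotone fun n => (S n).1 :=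
    monotone_nat_of_le_succ fun n => by rw [hS]; exact hsub _
  refine ⟨⋃ n, (S n).1, Set.countable_iUnion fun n => (S n).2,
    Set.subset_iUnion (fun n => (S n).1) 0, ?_, ?_⟩
  · intro x hx
    rw [SetLike.mem_coe, Submodule.span_iUnion, Submodule.mem_iSup_of_directed _
      (Monotone.directed_le fun m n hmn => Submodule.span_mono (hmono hmn))] at hx
    obtain ⟨n, hn⟩ := hx
    have := hspan (S n) hn
    rw [← hS] at this
    exact closure_mono (Set.subset_iUnion (fun n => (S n).1) (n + 1)) this
  · intro f hf
    rw [SetLike.mem_coe, Set.image_iUnion, Submodule.span_iUnion, Submodule.mem_iSup_of_directed _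
      (Monotone.directed_le fun m n hmn =>
        Submodule.span_mono (Set.image_mono (hmono hmn)))] at hf
    obtain ⟨n, hn⟩ := hf
    have := hdual (S n) hn
    rw [← hS] at this
    have hle : {f | h f ∈ (S (n + 1)).1} ⊆ {f | h f ∈ ⋃ n, (S n).1} :=
      fun f hf => Set.mem_iUnion.2 ⟨n + 1, hf⟩
    exact closure_mono hle this

/-- In a reflexive space every separable subspace lies in a separable complemented one. The range
`Z` of the projection is the closed span of the countable set `A` of
`exists_countable_back_and_forth`, its kernel `W` is the common kernel of the functionals norming
`A`. These functionals give `‖z‖ ≤ ‖z + w‖`, so `Z ⊕ W` is closed; a functional vanishing on it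
lies in the closed span `F` of the norming functionals, by reflexivity, and vanishes on `Z`, which
norms `F`. -/
theorem IsReflexive.exists_separable_projection [CompleteSpace X] (hX : IsReflexive 𝕜 X)
    (Y : Set X) (hY : TopologicalSpace.IsSeparable Y) :
    ∃ P : X →L[𝕜] X, (∀ x, P (P x) = P x) ∧ (∀ y ∈ Y, P y = y) ∧
      TopologicalSpace.IsSeparable (Set.range P) := by
  choose g hg1 hg using exists_dual_vector'' (E := X) 𝕜
  choose h hh1 hh using hX.exists_norming_vector
  obtain ⟨D, -, hDc, hD⟩ := hY.exists_countable_dense_subset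
  obtain ⟨A, hAc, hDA, hspan, hdual⟩ := exists_countable_back_and_forth g h hDc
  let Z := (Submodule.span 𝕜 A).topologicalClosure
  have hZc : IsClosed (Z : Set X) := Submodule.isClosed_topologicalClosure _
  have hZA : (Z : Set X) ⊆ closure A := closure_minimal hspan isClosed_closure
  have hAZ : A ⊆ Z := Submodule.subset_span.trans (Submodule.le_topologicalClosure _)
  let W : Submodule 𝕜 X :=
    { carrier := {x | ∀ f ∈ g '' A, f x = 0}
      add_mem' := fun {x y} hx hy f hf => by rw [map_add, hx f hf, hy f hf, add_zero]
      zero_mem' := fun f _ => map_zero f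
      smul_mem' := fun c x hx f hf => by rw [map_smul, hx f hf, smul_zero] }
  have hWc : IsClosed (W : Set X) := isClosed_dualCoannihilator _
  have hbound : ∀ z ∈ Z, ∀ w ∈ W, ‖z‖ ≤ ‖z + w‖ := by
    intro z hz w hw
    have hcl : IsClosed {z : X | ‖z‖ ≤ ‖z + w‖} :=
      isClosed_le continuous_norm (continuous_id.add continuous_const).norm
    refine closure_minimal (fun a ha => ?_) hcl (hZA hz)
    have h1 : ‖g a (a + w)‖ = ‖a‖ := by
      rw [map_add, hw _ ⟨a, ha, rfl⟩, add_zero, hg]; simp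
    rw [Set.mem_ofPred_eq, ← h1]
    exact (g a).le_of_opNorm_le (hg1 a) (a + w) |>.trans (by simp)
  have hdisj : Disjoint Z W := by
    rw [Submodule.disjoint_def]
    intro x hx hx'
    simpa using hbound x hx (-x) (W.neg_mem hx')
  have hsup_closed : IsClosed ((Z ⊔ W : Submodule 𝕜 X) : Set X) := by
    have := hZc.completeSpace_coe
    have := hWc.completeSpace_coe
    have hanti : AntilipschitzWith 2 (Z.subtypeL.coprod W.subtypeL) := by
      refine ContinuousLinearMap.antilipschitz_of_bound _ fun x => ?_
      have h1 := hbound x.1 x.1.2 x.2 x.2.2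
      have h2 : ‖(x.2 : X)‖ ≤ ‖(x.1 + x.2 : X)‖ + ‖(x.1 : X)‖ := by
        simpa using norm_sub_le (x.1 + x.2 : X) x.1
      rw [Prod.norm_def]
      refine max_le ?_ ?_ <;> simp only [Submodule.coe_norm, NNReal.coe_ofNat,
        ContinuousLinearMap.coprod_apply, Submodule.subtypeL_apply] <;>
        linarith [norm_nonneg (x.1 : X), norm_nonneg (x.1 + x.2 : X)]
    have := hanti.isClosed_range (Z.subtypeL.coprod W.subtypeL).uniformContinuous
    convert this using 1
    ext x
    simp [Submodule.mem_sup]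
  have hsup : Z ⊔ W = ⊤ := by
    by_contra hne
    obtain ⟨x, -, hx⟩ := SetLike.exists_of_lt (lt_top_iff_ne_top.2 hne)
    obtain ⟨f, hf0, hf1⟩ := exists_dual_eq_one_of_notMem _ hsup_closed hx
    let F := (Submodule.span 𝕜 (g '' A)).topologicalClosure
    have hfF : f ∈ F := by
      by_contra hfF
      obtain ⟨Φ, hΦ0, hΦ1⟩ :=
        exists_dual_eq_one_of_notMem F (Submodule.isClosed_topologicalClosure _) hfF
      obtain ⟨w, rfl⟩ := hX Φ
      simp only [NormedSpace.dual_def] at hΦ0 hΦ1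
      have hw : w ∈ W := fun f hf =>
        hΦ0 f (Submodule.le_topologicalClosure _ (Submodule.subset_span hf))
      rw [hf0 w (Submodule.mem_sup_right hw)] at hΦ1
      exact zero_ne_one hΦ1
    have hfcl : f ∈ closure {f | h f ∈ A} := closure_minimal hdual isClosed_closure hfF
    have hcl : IsClosed {b : StrongDual 𝕜 X | ‖b‖ ≤ ‖b - f‖} :=
      isClosed_le continuous_norm (continuous_id.sub continuous_const).norm
    have hnorm : ‖f‖ ≤ ‖f - f‖ := by
      refine closure_minimal (fun b hb => ?_) hcl hfcl
      have h1 : ‖(b - f) (h b)‖ = ‖b‖ := by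
        rw [sub_apply, hf0 _ (Submodule.mem_sup_left (hAZ hb)), sub_zero, hh]
        simp
      rw [Set.mem_ofPred_eq, ← h1]
      exact (b - f).unit_le_opNorm _ (hh1 b)
    have hf : f = 0 := by simpa using hnorm
    rw [hf] at hf1
    exact zero_ne_one hf1
  obtain ⟨Q, hQ⟩ := Submodule.ClosedComplemented.of_isCompl_isClosed
    ⟨hdisj, codisjoint_iff.2 hsup⟩ hZc hWc
  have hQZ : ∀ z ∈ Z, (Q z : X) = z := fun z hz => by rw [hQ ⟨z, hz⟩]
  refine ⟨Z.subtypeL ∘L Q, fun x => ?_, fun y hy => ?_, ?_⟩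
  · exact hQZ _ (Q x).2
  · exact hQZ y (closure_minimal (hDA.trans hAZ) hZc (hD hy))
  · refine (hAc.isSeparable.closure).mono ?_
    rintro _ ⟨x, rfl⟩
    exact hZA (Q x).2

/-! ### Biorthogonal sequences and a small locally nilpotent operator -/

/-- Definition by course-of-values recursion on `ℕ`. -/
theorem exists_nat_strongRec {α : Type*} (F : ∀ n : ℕ, (Fin n → α) → α) :
    ∃ f : ℕ → α, ∀ n, f n = F n fun i : Fin n => f i := by
  refine ⟨fun n => Nat.strongRecOn n fun n ih => F n fun i => ih i i.2, fun n => ?_⟩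
  simp only
  rw [Nat.strongRecOn_eq]

theorem exists_linearIndependent_seq {Z : Submodule 𝕜 X}
    (hsep : TopologicalSpace.IsSeparable (Z : Set X)) (hdim : ¬ FiniteDimensional 𝕜 Z) :
    ∃ x : ℕ → X, LinearIndependent 𝕜 x ∧ (∀ n, x n ∈ Z) ∧
      (Z : Set X) ⊆ closure (Submodule.span 𝕜 (Set.range x) : Set X) := by
  obtain ⟨s, hsZ, hsc, hs⟩ := hsep.exists_countable_dense_subset
  obtain ⟨b, hbs, hspan, hli⟩ := exists_linearIndependent 𝕜 s
  have hZb : (Z : Set X) ⊆ closure (Submodule.span 𝕜 b : Set X) :=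
    hs.trans (closure_mono (hspan ▸ Submodule.subset_span))
  have hinf : Infinite b := by
    rw [Set.infinite_coe_iff]
    intro hfin
    have : FiniteDimensional 𝕜 (Submodule.span 𝕜 b) := FiniteDimensional.span_of_finite 𝕜 hfin
    rw [(Submodule.closed_of_finiteDimensional (Submodule.span 𝕜 b)).closure_eq] at hZb
    exact hdim (Submodule.finiteDimensional_of_le hZb)
  have hcount : Countable b := (hsc.mono hbs).to_subtype
  obtain ⟨d⟩ := nonempty_denumerable b
  let i := (Denumerable.eqv b).symm
  refine ⟨fun n => (i n : X), hli.comp i i.injective, fun n => hsZ (hbs (i n).2), ?_⟩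
  have : Set.range (fun n => (i n : X)) = b := by
    rw [show (fun n => (i n : X)) = Subtype.val ∘ i from rfl, i.surjective.range_comp,
      Subtype.range_coe]
  rwa [this]

/-- Gram–Schmidt: the functionals `g n` vanish on the earlier vectors of the linearly independent
sequence `x`, which is then corrected to be killed by the earlier functionals. -/
theorem exists_biorthogonal {x : ℕ → X} (hx : LinearIndependent 𝕜 x) :
    ∃ (e : ℕ → X) (g : ℕ → StrongDual 𝕜 X), (∀ i j, g i (e j) = if i = j then 1 else 0) ∧
      Submodule.span 𝕜 (Set.range e) = Submodule.span 𝕜 (Set.range x) := by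
  have hg : ∀ n, ∃ g : StrongDual 𝕜 X, (∀ j < n, g (x j) = 0) ∧ g (x n) = 1 := by
    intro n
    have : FiniteDimensional 𝕜 (Submodule.span 𝕜 (x '' Set.Iio n)) :=
      FiniteDimensional.span_of_finite 𝕜 ((Set.finite_Iio n).image x)
    obtain ⟨g, h0, h1⟩ := exists_dual_eq_one_of_notMem (Submodule.span 𝕜 (x '' Set.Iio n))
      (Submodule.closed_of_finiteDimensional _)
      (hx.notMem_span_image (by simp : n ∉ Set.Iio n))
    exact ⟨g, fun j hj => h0 _ (Submodule.subset_span ⟨j, hj, rfl⟩), h1⟩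
  choose g hg0 hg1 using hg
  obtain ⟨e, he⟩ := exists_nat_strongRec fun n (e : Fin n → X) => x n - ∑ i : Fin n, g i (x n) • e i
  replace he : ∀ n, e n = x n - ∑ i ∈ Finset.range n, g i (x n) • e i := fun n => by
    rw [he, Finset.sum_range]
  -- the later functionals annihilate `e n`, a combination of `x 0, …, x n`
  have hlater : ∀ n i, n < i → g i (e n) = 0 := by
    intro n
    induction n using Nat.strong_induction_on with
    | _ n ih =>
      intro i hi
      rw [he, map_sub, hg0 i n hi, map_sum, Finset.sum_eq_zero, sub_zero]
      intro j hj
      have hj := Finset.mem_range.1 hj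
      rw [map_smul, ih j hj i (hj.trans hi), smul_zero]
  have hself : ∀ n, g n (e n) = 1 := by
    intro n
    rw [he, map_sub, hg1, map_sum, Finset.sum_eq_zero, sub_zero]
    intro j hj
    rw [map_smul, hlater j n (Finset.mem_range.1 hj), smul_zero]
  have hearlier : ∀ n i, i < n → g i (e n) = 0 := by
    intro n
    induction n using Nat.strong_induction_on with
    | _ n ih =>
      intro i hi
      rw [he, map_sub, map_sum, Finset.sum_eq_single i]
      · rw [map_smul, hself]; simp
      · intro j hj hji
        rw [map_smul]
        rcases lt_or_gt_of_ne hji with h | h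
        · rw [hlater j i h, smul_zero]
        · rw [ih j (Finset.mem_range.1 hj) i h, smul_zero]
      · intro h; exact absurd (Finset.mem_range.2 hi) h
  refine ⟨e, g, fun i j => ?_, le_antisymm ?_ ?_⟩
  · split_ifs with h
    · rw [h, hself]
    · rcases lt_or_gt_of_ne h with h | h
      · exact hearlier j i h
      · exact hlater j i h
  · rw [Submodule.span_le, Set.range_subset_iff]
    intro n
    induction n using Nat.strong_induction_on with
    | _ n ih =>
      rw [he]
      exact Submodule.sub_mem _ (Submodule.subset_span ⟨n, rfl⟩)
        (Submodule.sum_mem _ fun j hj => Submodule.smul_mem _ _ (ih j (Finset.mem_range.1 hj)))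
  · rw [Submodule.span_le, Set.range_subset_iff]
    intro n
    rw [← sub_add_cancel (x n) (∑ i ∈ Finset.range n, g i (x n) • e i), ← he]
    exact Submodule.add_mem _ (Submodule.subset_span ⟨n, rfl⟩)
      (Submodule.sum_mem _ fun j _ => Submodule.smul_mem _ _ (Submodule.subset_span ⟨j, rfl⟩))

/-- An operator of small norm acting on a sequence `f` as `p ↦ p(x + 1) - p(x)` acts on the
monomials. Rescaling a biorthogonal system by rapidly increasing factors `c` makes the nuclear
norm of the operator small. -/
theorem exists_small_forward_difference [CompleteSpace X] {x : ℕ → X}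
    (hx : LinearIndependent 𝕜 x) {δ : ℝ} (hδ : 0 < δ) :
    ∃ (f : ℕ → X) (K : X →L[𝕜] X), ‖K‖ ≤ δ ∧
      Submodule.span 𝕜 (Set.range f) = Submodule.span 𝕜 (Set.range x) ∧
      ∀ n, K (f n) = ∑ i ∈ Finset.range n, (n.choose i : 𝕜) • f i := by
  obtain ⟨e, g, hge, hspan⟩ := exists_biorthogonal hx
  obtain ⟨c, hc⟩ := exists_nat_strongRec fun n (c : Fin n → ℝ) =>
    (2 / δ) * 2 ^ n * (1 + ‖g n‖ * ∑ i : Fin n, n.choose i * (|c i| * ‖e i‖))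
  replace hc : ∀ n, c n = (2 / δ) * 2 ^ n *
      (1 + ‖g n‖ * ∑ i ∈ Finset.range n, n.choose i * (|c i| * ‖e i‖)) := fun n => by
    rw [hc, Finset.sum_range]
  have hs : ∀ n, 0 ≤ ‖g n‖ * ∑ i ∈ Finset.range n, (n.choose i : ℝ) * (|c i| * ‖e i‖) :=
    fun n => mul_nonneg (norm_nonneg _) (Finset.sum_nonneg fun i _ => by positivity)
  have hcpos : ∀ n, 0 < c n := fun n => by
    rw [hc]; have := hs n; positivity
  let f : ℕ → X := fun n => (c n : 𝕜) • e n
  let w : ℕ → X := fun n => ∑ i ∈ Finset.range n, (n.choose i : 𝕜) • f i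
  let R : ℕ → X →L[𝕜] X := fun n => ((c n : 𝕜)⁻¹ • g n).smulRight (w n)
  have hw : ∀ n, ‖w n‖ ≤ ∑ i ∈ Finset.range n, (n.choose i : ℝ) * (|c i| * ‖e i‖) := fun n =>
    (norm_sum_le _ _).trans_eq (Finset.sum_congr rfl fun i _ => by
      simp [f, norm_smul])
  have hR : ∀ n, ‖R n‖ ≤ δ / 2 / 2 ^ n := by
    intro n
    rw [ContinuousLinearMap.norm_smulRight_apply, norm_smul, norm_inv, RCLike.norm_ofReal,
      abs_of_pos (hcpos n), mul_assoc, inv_mul_le_iff₀ (hcpos n)]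
    have h1 : c n * (δ / 2 / 2 ^ n) =
        1 + ‖g n‖ * ∑ i ∈ Finset.range n, (n.choose i : ℝ) * (|c i| * ‖e i‖) := by
      rw [hc]; field_simp
    rw [h1]
    have := mul_le_mul_of_nonneg_left (hw n) (norm_nonneg (g n))
    linarith
  have hsum := hasSum_geometric_two' δ
  have hRs : Summable R := Summable.of_norm_bounded hsum.summable hR
  refine ⟨f, ∑' n, R n, tsum_of_norm_bounded hsum hR, ?_, fun n => ?_⟩
  · rw [← hspan]
    refine le_antisymm ?_ ?_ <;> rw [Submodule.span_le, Set.range_subset_iff] <;> intro n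
    · exact Submodule.smul_mem _ _ (Submodule.subset_span ⟨n, rfl⟩)
    · have hne : (c n : 𝕜) ≠ 0 := by exact_mod_cast (hcpos n).ne'
      rw [← inv_smul_smul₀ hne (e n)]
      exact Submodule.smul_mem _ _ (Submodule.subset_span ⟨n, rfl⟩)
  · have hne : (c n : 𝕜) ≠ 0 := by exact_mod_cast (hcpos n).ne'
    have h1 : (∑' n, R n) (f n) = ∑' m, R m (f n) :=
      ContinuousLinearMap.map_tsum (ContinuousLinearMap.apply 𝕜 X (f n)) hRs
    rw [h1, tsum_eq_single n]
    · simp [R, f, hge, hne, w]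
    · intro m hm
      simp [R, f, hge, hm]

end

section

variable {𝕜 : Type*} [RCLike 𝕜] {E : Type*} [NormedAddCommGroup E] [NormedSpace 𝕜 E]

/-! ### The mixing relation of an operator -/

/-- The pairs `(x, y)` such that, for all large `n`, some point arbitrarily close to `x` is mapped
by `T ^ n` arbitrarily close to `y`. In contrast to `y ∈ JSet T x`, the full sequence of powers is
used, which makes this a linear subspace. -/
def mixingSubmodule (T : E →L[𝕜] E) : Submodule 𝕜 (E × E) where
  carrier := {p | ∀ ε > 0, ∀ᶠ n : ℕ in atTop, ∃ u, ‖u - p.1‖ < ε ∧ ‖(T ^ n) u - p.2‖ < ε}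
  zero_mem' := fun ε hε => Eventually.of_forall fun n => ⟨0, by simpa using hε, by simpa using hε⟩
  add_mem' := by
    intro p q hp hq ε hε
    filter_upwards [hp (ε / 2) (half_pos hε), hq (ε / 2) (half_pos hε)]
      with n ⟨u, hu, hu'⟩ ⟨v, hv, hv'⟩
    refine ⟨u + v, ?_, ?_⟩
    · rw [Prod.fst_add, add_sub_add_comm]
      linarith [norm_add_le (u - p.1) (v - q.1)]
    · rw [Prod.snd_add, map_add, add_sub_add_comm]
      linarith [norm_add_le ((T ^ n) u - p.2) ((T ^ n) v - q.2)]
  smul_mem' := by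
    intro a p hp ε hε
    have ha : 0 < ‖a‖ + 1 := by positivity
    filter_upwards [hp (ε / (‖a‖ + 1)) (div_pos hε ha)] with n ⟨u, hu, hu'⟩
    have key : ∀ z : E, ‖z‖ < ε / (‖a‖ + 1) → ‖a • z‖ < ε := fun z hz => by
      rw [lt_div_iff₀ ha] at hz
      rw [norm_smul]
      linarith [norm_nonneg z]
    refine ⟨a • u, ?_, ?_⟩
    · rw [Prod.smul_fst, ← smul_sub]; exact key _ hu
    · rw [Prod.smul_snd, map_smul, ← smul_sub]; exact key _ hu'

theorem mem_mixingSubmodule_of_tendsto {T : E →L[𝕜] E} {x y : E} {u : ℕ → E}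
    (hu : Tendsto u atTop (𝓝 x)) (hTu : Tendsto (fun n => (T ^ n) (u n)) atTop (𝓝 y)) :
    (x, y) ∈ mixingSubmodule T := by
  intro ε hε
  filter_upwards [Metric.tendsto_nhds.1 hu ε hε, Metric.tendsto_nhds.1 hTu ε hε] with n h1 h2
  exact ⟨u n, by rwa [← dist_eq_norm], by rwa [← dist_eq_norm]⟩

theorem isClosed_mixingSubmodule (T : E →L[𝕜] E) :
    IsClosed (mixingSubmodule T : Set (E × E)) := by
  refine isClosed_of_closure_subset fun p hp ε hε => ?_
  obtain ⟨q, hq, hpq⟩ := Metric.mem_closure_iff.1 hp (ε / 2) (half_pos hε)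
  rw [Prod.dist_eq, max_lt_iff, dist_comm, dist_comm p.2, dist_eq_norm, dist_eq_norm] at hpq
  filter_upwards [hq (ε / 2) (half_pos hε)] with n ⟨u, hu, hu'⟩
  refine ⟨u, ?_, ?_⟩
  · linarith [norm_sub_le_norm_sub_add_norm_sub u q.1 p.1]
  · linarith [norm_sub_le_norm_sub_add_norm_sub ((T ^ n) u) q.2 p.2]

theorem mem_jSet_of_mem_mixingSubmodule {T : E →L[𝕜] E} {x y : E}
    (h : (x, y) ∈ mixingSubmodule T) : y ∈ JSet T x := by
  obtain ⟨k, hk, hu⟩ := extraction_forall_of_eventually fun j : ℕ =>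
    h (1 / ((j : ℝ) + 1)) Nat.one_div_pos_of_nat
  choose u hu hTu using hu
  refine ⟨k, u, hk, ?_, ?_⟩
  · exact tendsto_iff_norm_sub_tendsto_zero.2 (squeeze_zero (fun _ => norm_nonneg _)
      (fun n => (hu n).le) tendsto_one_div_add_atTop_nhds_zero_nat)
  · exact tendsto_iff_norm_sub_tendsto_zero.2 (squeeze_zero (fun _ => norm_nonneg _)
      (fun n => (hTu n).le) tendsto_one_div_add_atTop_nhds_zero_nat)

/-- Vectors in an eigenspace with eigenvalue outside the closed unit disc are limits of images of
the null sequence `μ ^ (-n) • w`. -/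
theorem zero_pair_mem_mixingSubmodule_of_eigenvector {T : E →L[𝕜] E} {w : E} {μ : 𝕜}
    (hμ : 1 < ‖μ‖) (hw : T w = μ • w) : ((0 : E), w) ∈ mixingSubmodule T := by
  have hμ0 : μ ≠ 0 := norm_pos_iff.1 (zero_lt_one.trans hμ)
  have hpow : ∀ n : ℕ, (T ^ n) w = μ ^ n • w := by
    intro n
    induction n with
    | zero => simp
    | succ n ih => rw [pow_succ, mul_apply_eq_comp, hw, map_smul, ih, smul_smul,
        ← pow_succ']
  refine mem_mixingSubmodule_of_tendsto (u := fun n => (μ⁻¹) ^ n • w) ?_ ?_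
  · have := (tendsto_pow_atTop_nhds_zero_of_norm_lt_one
      (show ‖μ⁻¹‖ < 1 by rw [norm_inv]; exact inv_lt_one_of_one_lt₀ hμ)).smul_const w
    rwa [zero_smul] at this
  · refine tendsto_const_nhds.congr fun n => ?_
    rw [map_smul, hpow, smul_smul, inv_pow, inv_mul_cancel₀ (pow_ne_zero n hμ0), one_smul]

/-! ### Translation of polynomials is mixing -/

open Polynomial in
/-- A polynomial family depending polynomially on a parameter `t` gives a continuous curve under
every linear map, since it involves only finitely many coefficients. -/
theorem continuous_linearMap_eval (φ : 𝕜[X] →ₗ[𝕜] E) (P : 𝕜[X][X]) :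
    Continuous fun t : 𝕜 => φ (P.eval (C t)) := by
  have : (fun t : 𝕜 => φ (P.eval (C t))) =
      fun t => ∑ i ∈ Finset.range (P.natDegree + 1), t ^ i • φ (P.coeff i) := by
    funext t
    rw [eval_eq_sum_range, map_sum]
    refine Finset.sum_congr rfl fun i _ => ?_
    rw [← map_smul, ← C_pow, mul_comm, smul_eq_C_mul]
  rw [this]
  fun_prop

open Polynomial in
theorem tendsto_linearMap_eval_inv (φ : 𝕜[X] →ₗ[𝕜] E) (P : 𝕜[X][X]) :
    Tendsto (fun n : ℕ => φ (P.eval (C (n : 𝕜)⁻¹))) atTop (𝓝 (φ (P.eval 0))) := by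
  have h := (continuous_linearMap_eval φ P).tendsto 0
  rw [C_0] at h
  exact h.comp (tendsto_inv_atTop_nhds_zero_nat (𝕜 := 𝕜))

open Polynomial in
/-- If `T` acts on the image of the polynomials as the translation by `1`, then all pairs `(x, 0)`
and `(0, x)` with `x` in the image belong to the mixing relation. For `x = φ (X ^ m)` the witnesses
are, with `t = 1 / n`, the polynomial `X ^ m * (1 - t * X) ^ (m + 1)`, whose translate by `n` is
`t * (1 + t * X) ^ m * (-X) ^ (m + 1)`, and the polynomial `t * X ^ (m + 1) * (t * X - 1) ^ m`,
whose translate is `(1 + t * X) ^ (m + 1) * X ^ m`. -/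
theorem pair_mem_mixingSubmodule_of_translation {T : E →L[𝕜] E} (φ : 𝕜[X] →ₗ[𝕜] E)
    (hT : ∀ p, T (φ p) = φ (taylor 1 p)) (p q : 𝕜[X]) :
    (φ p, φ q) ∈ mixingSubmodule T := by
  have hpow : ∀ (n : ℕ) (p : 𝕜[X]), (T ^ n) (φ p) = φ (taylor (n : 𝕜) p) := by
    intro n
    induction n with
    | zero => intro p; simp
    | succ n ih =>
      intro p
      rw [pow_succ, mul_apply_eq_comp, hT, ih, taylor_taylor, Nat.cast_succ]
  have htr : ∀ n : ℕ, n ≠ 0 → C (n : 𝕜)⁻¹ * (C (n : 𝕜) : 𝕜[X]) = 1 := fun n hn => by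
    rw [← C_mul, inv_mul_cancel₀ (Nat.cast_ne_zero.2 hn), C_1]
  have hleft : ∀ m : ℕ, (φ (X ^ m), (0 : E)) ∈ mixingSubmodule T := by
    intro m
    have h1 := tendsto_linearMap_eval_inv φ ((C X) ^ m * (1 - X * C X) ^ (m + 1))
    have h2 := tendsto_linearMap_eval_inv φ (X * (1 + X * C X) ^ m * (C (-X)) ^ (m + 1))
    simp only [eval_mul, eval_pow, eval_C, eval_X, eval_sub, eval_add, eval_one,
      zero_mul, sub_zero, one_pow, mul_one, map_zero] at h1 h2
    refine mem_mixingSubmodule_of_tendsto h1 (h2.congr' ?_)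
    filter_upwards [eventually_ne_atTop 0] with n hn
    rw [hpow]
    congr 1
    simp only [taylor_mul, taylor_pow, map_sub, taylor_one, taylor_X, taylor_C, map_one]
    have e1 : 1 - C (n : 𝕜)⁻¹ * ((X : 𝕜[X]) + C (n : 𝕜)) = C (n : 𝕜)⁻¹ * (-X) := by
      linear_combination -(htr n hn)
    have e2 : 1 + C (n : 𝕜)⁻¹ * (X : 𝕜[X]) = C (n : 𝕜)⁻¹ * (X + C (n : 𝕜)) := by
      linear_combination -(htr n hn)
    rw [e1, e2, mul_pow, mul_pow, pow_succ (C (n : 𝕜)⁻¹)]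
    ring
  have hright : ∀ m : ℕ, ((0 : E), φ (X ^ m)) ∈ mixingSubmodule T := by
    intro m
    have h1 := tendsto_linearMap_eval_inv φ (X * (C X) ^ (m + 1) * (X * C X - 1) ^ m)
    have h2 := tendsto_linearMap_eval_inv φ ((1 + X * C X) ^ (m + 1) * (C X) ^ m)
    simp only [eval_mul, eval_pow, eval_C, eval_X, eval_sub, eval_add, eval_one,
      zero_mul, add_zero, one_pow, one_mul, map_zero] at h1 h2
    refine mem_mixingSubmodule_of_tendsto h1 (h2.congr' ?_)
    filter_upwards [eventually_ne_atTop 0] with n hn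
    rw [hpow]
    congr 1
    simp only [taylor_mul, taylor_pow, map_sub, taylor_one, taylor_X, taylor_C, map_one]
    have e1 : C (n : 𝕜)⁻¹ * ((X : 𝕜[X]) + C (n : 𝕜)) - 1 = C (n : 𝕜)⁻¹ * X := by
      linear_combination (htr n hn)
    have e2 : 1 + C (n : 𝕜)⁻¹ * (X : 𝕜[X]) = C (n : 𝕜)⁻¹ * (X + C (n : 𝕜)) := by
      linear_combination -(htr n hn)
    rw [e1, e2, mul_pow, mul_pow, pow_succ (C (n : 𝕜)⁻¹)]
    ring
  have key : ∀ (L : E →ₗ[𝕜] E × E), (∀ m : ℕ, L (φ (X ^ m)) ∈ mixingSubmodule T) →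
      ∀ p, L (φ p) ∈ mixingSubmodule T := by
    intro L hL p
    induction p using Polynomial.induction_on' with
    | add p q hp hq => rw [map_add, map_add]; exact add_mem hp hq
    | monomial n a =>
      rw [← C_mul_X_pow_eq_monomial, ← smul_eq_C_mul, map_smul, map_smul]
      exact Submodule.smul_mem _ _ (hL n)
  have h := add_mem (key (LinearMap.inl 𝕜 E E) hleft p) (key (LinearMap.inr 𝕜 E E) hright q)
  simpa using h

open Polynomial in
/-- Criterion in terms of a sequence `f`: `T` acts as the translation by `1` on the polynomials,
`f n` standing for `X ^ n`. -/
theorem pair_mem_mixingSubmodule_of_binomial {T : E →L[𝕜] E} {f : ℕ → E}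
    (hT : ∀ n, T (f n) = f n + ∑ i ∈ Finset.range n, (n.choose i : 𝕜) • f i) {x y : E}
    (hx : x ∈ closure (Submodule.span 𝕜 (Set.range f) : Set E))
    (hy : y ∈ closure (Submodule.span 𝕜 (Set.range f) : Set E)) :
    (x, y) ∈ mixingSubmodule T := by
  let φ : 𝕜[X] →ₗ[𝕜] E := (basisMonomials 𝕜).constr 𝕜 f
  have hφ : ∀ n, φ (X ^ n) = f n := fun n => by
    have := (basisMonomials 𝕜).constr_basis 𝕜 f n
    rw [coe_basisMonomials] at this
    rw [← monomial_one_right_eq_X_pow]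
    exact this
  have hTφ : ∀ p, T (φ p) = φ (taylor 1 p) := by
    intro p
    induction p using Polynomial.induction_on' with
    | add p q hp hq => simp only [map_add, hp, hq]
    | monomial n a =>
      rw [← C_mul_X_pow_eq_monomial, ← smul_eq_C_mul, map_smul, map_smul, map_smul, map_smul,
        taylor_X_pow, C_1, add_pow, map_sum, Finset.sum_range_succ, hφ, hT, add_comm]
      congr 2
      · refine Finset.sum_congr rfl fun i _ => ?_
        rw [one_pow, mul_one, mul_comm, ← C_eq_natCast, ← smul_eq_C_mul, map_smul, hφ]
      · simp [hφ]
  have hrange : (Submodule.span 𝕜 (Set.range f) : Set E) ⊆ Set.range φ := by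
    rw [← LinearMap.coe_range, SetLike.coe_subset_coe, Submodule.span_le, Set.range_subset_iff]
    exact fun n => ⟨X ^ n, hφ n⟩
  have hmem : (x, y) ∈ closure ((Submodule.span 𝕜 (Set.range f) : Set E) ×ˢ
      (Submodule.span 𝕜 (Set.range f) : Set E)) := by
    rw [closure_prod_eq]; exact ⟨hx, hy⟩
  refine closure_minimal ?_ (isClosed_mixingSubmodule T) hmem
  rintro ⟨a, b⟩ ⟨ha, hb⟩
  obtain ⟨p, rfl⟩ := hrange ha
  obtain ⟨q, rfl⟩ := hrange hb
  exact pair_mem_mixingSubmodule_of_translation φ hTφ p q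

end

end JClass

/-! ### Construction of the operator -/

theorem theorem1p19 {𝕜 : Type*} [RCLike 𝕜] {X : Type*} [NormedAddCommGroup X]
    [NormedSpace 𝕜 X] [CompleteSpace X]
    (hrefl : JClass.IsReflexive 𝕜 X)
    (hnonsep : ¬ TopologicalSpace.SeparableSpace X)
    (Y : Submodule 𝕜 X) (hYclosed : IsClosed (Y : Set X))
    (hYsep : TopologicalSpace.SeparableSpace Y)
    (hYdim : ¬ FiniteDimensional 𝕜 Y)
    (c : ℝ) (hc : 1 < c) :
    ∃ T : X →L[𝕜] X, JClass.IsJClass T ∧ (Y : Set X) ⊆ JClass.ASet T ∧ ‖T‖ = c := by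
  obtain ⟨P, hPP, hPY, hPsep⟩ := hrefl.exists_separable_projection (Y : Set X)
    (.of_subtype (Y : Set X))
  have hYZ : Y ≤ P.range := fun y hy => ⟨y, hPY y hy⟩
  have hZdim : ¬ FiniteDimensional 𝕜 P.range :=
    fun h => hYdim (Submodule.finiteDimensional_of_le hYZ)
  obtain ⟨x, hxli, hxZ, hxdense⟩ :=
    JClass.exists_linearIndependent_seq (Z := P.range) (by rw [LinearMap.coe_range]; exact hPsep) hZdim
  have hP : 0 < ‖P‖ + 1 := by positivity
  obtain ⟨f, K, hK, hspan, hKf⟩ := JClass.exists_small_forward_difference hxli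
    (show 0 < (c - 1) / 2 / (‖P‖ + 1) from div_pos (by linarith) hP)
  have hfZ : ∀ n, P (f n) = f n := by
    intro n
    have hle : Submodule.span 𝕜 (Set.range f) ≤ P.range := by
      rw [hspan, Submodule.span_le, Set.range_subset_iff]
      exact hxZ
    obtain ⟨u, hu⟩ := hle (Submodule.subset_span ⟨n, rfl⟩)
    rw [← hu]
    exact hPP u
  have hPcl : ∀ x, P x ∈ closure (Submodule.span 𝕜 (Set.range f) : Set X) := fun x => by
    rw [hspan]
    exact hxdense ⟨x, rfl⟩
  -- the kernel of `P` is nonzero because `X` is not separable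
  obtain ⟨w, hw0, hPw⟩ : ∃ w : X, w ≠ 0 ∧ P w = 0 := by
    by_contra! hker
    refine hnonsep (TopologicalSpace.isSeparable_univ_iff.1 (hPsep.mono fun x _ => ⟨x, ?_⟩))
    by_contra hne
    exact hker (x - P x) (sub_ne_zero.2 (Ne.symm hne)) (by rw [map_sub, hPP, sub_self])
  let T : ℝ → X →L[𝕜] X := fun μ => P + (μ : 𝕜) • (ContinuousLinearMap.id 𝕜 X - P) + K ∘L P
  have hTapply : ∀ μ x, T μ x = P x + (μ : 𝕜) • (x - P x) + K (P x) := fun μ x => rfl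
  have hTcont : Continuous fun μ => ‖T μ‖ := by
    have : Continuous fun μ : ℝ => (μ : 𝕜) := RCLike.continuous_ofReal
    fun_prop
  have hT1 : ‖T 1‖ < c := by
    have h1 : T 1 = ContinuousLinearMap.id 𝕜 X + K ∘L P := by
      ext x
      simp [hTapply]
    have h2 : ‖K ∘L P‖ ≤ (c - 1) / 2 :=
      calc ‖K ∘L P‖ ≤ ‖K‖ * ‖P‖ := K.opNorm_comp_le P
        _ ≤ (c - 1) / 2 / (‖P‖ + 1) * (‖P‖ + 1) := by gcongr; linarith
        _ = (c - 1) / 2 := div_mul_cancel₀ _ hP.ne'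
    rw [h1]
    linarith [norm_add_le (ContinuousLinearMap.id 𝕜 X) (K ∘L P),
      ContinuousLinearMap.norm_id_le (𝕜 := 𝕜) (E := X)]
  have hTc : c ≤ ‖T c‖ := by
    have h1 : ‖T c w‖ = c * ‖w‖ := by
      rw [hTapply, hPw, map_zero, sub_zero, zero_add, add_zero, norm_smul, RCLike.norm_ofReal,
        abs_of_pos (by linarith)]
    have h2 := (T c).le_opNorm w
    rw [h1] at h2
    exact le_of_mul_le_mul_right h2 (norm_pos_iff.2 hw0)
  -- the norm takes the value `c` at some `μ`, and `μ ≠ 1` since the norm is smaller there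
  obtain ⟨μ, ⟨hμ1, -⟩, hμ⟩ := intermediate_value_Icc hc.le hTcont.continuousOn
    ⟨hT1.le, hTc⟩
  have hμ1 : 1 < μ := lt_of_le_of_ne hμ1 fun h => by
    rw [← h] at hμ
    exact hT1.ne hμ
  have hA : (Y : Set X) ⊆ JClass.ASet (T μ) := by
    intro y hy
    refine Set.eq_univ_of_forall fun v => JClass.mem_jSet_of_mem_mixingSubmodule ?_
    have h1 : (y, P v) ∈ JClass.mixingSubmodule (T μ) := by
      refine JClass.pair_mem_mixingSubmodule_of_binomial (f := f) (fun n => ?_) ?_ (hPcl v)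
      · rw [hTapply, hfZ, sub_self, smul_zero, add_zero, hKf]
      · rw [← hPY y hy]
        exact hPcl y
    have h2 : ((0 : X), v - P v) ∈ JClass.mixingSubmodule (T μ) := by
      refine JClass.zero_pair_mem_mixingSubmodule_of_eigenvector (μ := (μ : 𝕜)) ?_ ?_
      · rwa [RCLike.norm_ofReal, abs_of_pos (by linarith)]
      · have : P (v - P v) = 0 := by rw [map_sub, hPP, sub_self]
        rw [hTapply, this, map_zero, sub_zero, zero_add, add_zero]
    simpa using add_mem h1 h2
  obtain ⟨y, hy, hy0⟩ : ∃ y ∈ Y, y ≠ 0 := by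
    refine Y.exists_mem_ne_zero_of_ne_bot fun h => hYdim ?_
    rw [h]
    infer_instance
  exact ⟨T μ, ⟨y, hy0, hA hy⟩, hA, hμ⟩
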